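/- Let $d\ge 1$ be an integer and let $m>2$ be real. For a measurable function $\varrho:\mathbb R^d\to[0,\infty)$ with $0<\int\varrho\,dx<\infty$, let $\pi(A)=\int_A\varrho\,dx/\int_{\mathbb R^d}\varrho\,dx$ be the distribution with (unnormalized) density $\varrho$, and let $P_\pi$ be the transition kernel of uniform slice sampling (USS) for $\varrho$: from the current state $x$, draw $t$ uniformly from $(0,\varrho(x))$, and then draw the new state uniformly from the slice $\{y\in\mathbb R^d:\varrho(y)>t\}$. For a Markov kernel $P$ with invariant distribution $\pi$ put $\mathsf{gap}_\pi(P)=1-\|P-\pi\|_{L_2(\pi)\to L_2(\pi)}$, where $(Pg)(x)=\int g(y)\,P(x,dy)$ and $\pi$ acts by $g\mapsto\int g\,d\pi$. (i) Let $\chi:\mathbb S^{d-1}\to(0,\infty)$ be measurable on the Euclidean unit sphere, and let $\pi$ be a probability measure on $\mathbb R^d$ with density $\varrho$ given by $$\varrho(r\theta)=\Bigl(1+\tfrac1m\,\chi(\theta)\,r^2\Bigr)^{-(d+m)/2},\qquad r\ge 0,\ \theta\in\mathbb S^{d-1}$$ (so $\varrho$ is assumed to be integrable). Then $P_\pi$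 is a Markov kernel with invariant distribution $\pi$, and $$\mathsf{gap}_\pi(P_\pi)\ \ge\ 1-\frac{d(d+m)}{(d+1)(d+m-1)}.$$ (ii) Let $a\in\mathbb R^d$, let $\Sigma\in\mathbb R^{d\times d}$ be symmetric and positive definite, and let $$\varrho(x)=\Bigl(1+\tfrac1m\,(x-a)^T\Sigma^{-1}(x-a)\Bigr)^{-(d+m)/2},\qquad x\in\mathbb R^d.$$ Then $\varrho$ is the density of a probability measure $\pi$ (a multivariate $t$-distribution with $m$ degrees of freedom), $P_\pi$ is a Markov kernel with invariant distribution $\pi$, and the same lower bound on $\mathsf{gap}_\pi(P_\pi)$ holds. -/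

import Mathlib

open MeasureTheory ProbabilityTheory
open scoped ENNReal Matrix

namespace SliceSampling

/-- The probability measure on `ℝ^d` with (possibly unnormalized) Lebesgue density `ϱ`, that is,
`A ↦ (∫_A ϱ) / (∫ ϱ)`. For measurable `ϱ ≥ 0` this is a probability measure exactly if
`0 < ∫ ϱ < ∞`. -/
noncomputable def densityMeasure {d : ℕ} (ϱ : EuclideanSpace ℝ (Fin d) → ℝ) :
    Measure (EuclideanSpace ℝ (Fin d)) :=
  (∫⁻ x, ENNReal.ofReal (ϱ x))⁻¹ • volume.withDensity (fun x => ENNReal.ofReal (ϱ x))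

theorem measurable_cond_threshold {d : ℕ} {ϱ : EuclideanSpace ℝ (Fin d) → ℝ}
    (hϱ : Measurable ϱ) :
    Measurable (fun x => (volume : Measure ℝ)[|Set.Ioo 0 (ϱ x)]) := by
  refine Measure.measurable_of_measurable_coe _ fun s hs => ?_
  have hS : MeasurableSet {p : EuclideanSpace ℝ (Fin d) × ℝ | (0 < p.2 ∧ p.2 < ϱ p.1) ∧ p.2 ∈ s} :=
    ((measurableSet_lt measurable_const measurable_snd).inter
      (measurableSet_lt measurable_snd (hϱ.comp measurable_fst))).inter (measurable_snd hs)
  simp only [cond_apply measurableSet_Ioo, Real.volume_Ioo, sub_zero]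
  exact hϱ.ennreal_ofReal.inv.mul (measurable_measure_prodMk_left (ν := volume) hS)

theorem measurable_cond_slice {d : ℕ} {ϱ : EuclideanSpace ℝ (Fin d) → ℝ}
    (hϱ : Measurable ϱ) :
    Measurable (fun t : ℝ =>
      (volume : Measure (EuclideanSpace ℝ (Fin d)))[|{x | t < ϱ x}]) := by
  refine Measure.measurable_of_measurable_coe _ fun s hs => ?_
  have h (t : ℝ) : MeasurableSet {x | t < ϱ x} := measurableSet_lt measurable_const hϱ
  have hS : MeasurableSet {p : ℝ × EuclideanSpace ℝ (Fin d) | p.1 < ϱ p.2} :=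
    measurableSet_lt measurable_fst (hϱ.comp measurable_snd)
  simp only [cond_apply (h _)]
  exact (measurable_measure_prodMk_left (ν := volume) hS).inv.mul
    (measurable_measure_prodMk_left (ν := volume) (hS.inter (measurable_snd hs)))

/-- First step of uniform slice sampling: given the current state `x`, sample a threshold from the
uniform distribution on `(0, ϱ x)`. -/
noncomputable def thresholdKernel {d : ℕ} (ϱ : EuclideanSpace ℝ (Fin d) → ℝ)
    (hϱ : Measurable ϱ) : Kernel (EuclideanSpace ℝ (Fin d)) ℝ where
  toFun x := (volume : Measure ℝ)[|Set.Ioo 0 (ϱ x)]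
  measurable' := measurable_cond_threshold hϱ

/-- Second step of uniform slice sampling: given the threshold `t`, sample the new state from the
uniform distribution on the slice `{x | t < ϱ x}`. -/
noncomputable def sliceKernel {d : ℕ} (ϱ : EuclideanSpace ℝ (Fin d) → ℝ)
    (hϱ : Measurable ϱ) : Kernel ℝ (EuclideanSpace ℝ (Fin d)) where
  toFun t := (volume : Measure (EuclideanSpace ℝ (Fin d)))[|{x | t < ϱ x}]
  measurable' := measurable_cond_slice hϱ

/-- The transition kernel of uniform slice sampling for the density `ϱ`. -/
noncomputable def ussKernel {d : ℕ} (ϱ : EuclideanSpace ℝ (Fin d) → ℝ)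
    (hϱ : Measurable ϱ) :
    Kernel (EuclideanSpace ℝ (Fin d)) (EuclideanSpace ℝ (Fin d)) :=
  sliceKernel ϱ hϱ ∘ₖ thresholdKernel ϱ hϱ

/-- The operator norm of `P - ν` on `L₂(ν)`, with `(P g)(x) = ∫ g(y) P(x, dy)` and
`ν g = ∫ g dν`, as the supremum over the unit ball. -/
noncomputable def opNormSub {G : Type*} [MeasurableSpace G] (P : Kernel G G) (ν : Measure G) :
    ℝ≥0∞ :=
  ⨆ (g : G → ℝ) (_ : MemLp g 2 ν) (_ : eLpNorm g 2 ν ≤ 1),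
    eLpNorm (fun x => (∫ y, g y ∂(P x)) - ∫ y, g y ∂ν) 2 ν

/-- The spectral gap `1 - ‖P - ν‖` of a Markov kernel `P` with invariant distribution `ν`. -/
noncomputable def spectralGap {G : Type*} [MeasurableSpace G] (P : Kernel G G) (ν : Measure G) :
    EReal :=
  1 - (opNormSub P ν : EReal)

/-- The (unnormalized) density of the multivariate t-distribution on `ℝ^d` with `m` degrees of
freedom, location `a` and scale matrix `S`. -/
noncomputable def tDensity {d : ℕ} (m : ℝ) (a : EuclideanSpace ℝ (Fin d))
    (S : Matrix (Fin d) (Fin d) ℝ) (x : EuclideanSpace ℝ (Fin d)) : ℝ :=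
  (1 + 1 / m * ((x - a).ofLp ⬝ᵥ (S⁻¹ *ᵥ (x - a).ofLp))) ^ (-((d : ℝ) + m) / 2)

theorem measurable_tDensity {d : ℕ} (m : ℝ) (a : EuclideanSpace ℝ (Fin d))
    (S : Matrix (Fin d) (Fin d) ℝ) : Measurable (tDensity m a S) := by
  have h : Continuous fun x : EuclideanSpace ℝ (Fin d) =>
      1 + 1 / m * ((x - a).ofLp ⬝ᵥ (S⁻¹ *ᵥ (x - a).ofLp)) := by
    unfold dotProduct Matrix.mulVec dotProduct
    fun_prop
  exact h.measurable.pow_const _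

end SliceSampling

/-! Put `p = d + m` and write the density as `(1 + ρ (x - a) ^ 2) ^ (-p / 2)` with `ρ` positively
homogeneous, so that slices are dilates of the unit ball of `ρ`. Couple the moves from two states by
using the same relative level `u ∈ (0, 1)` and the same uniform point `z` of the unit ball. A state
at gauge distance `s` gets the slice radius `√((u ^ (-1/p) * s) ^ 2 + u ^ (-2/p) - 1)`, which is `u
^ (-1/p)`-Lipschitz in `s`, and the new gauge distance is this radius times `ρ z`. Since `u ^
(-1/p)` has mean `p / (p - 1)` and `ρ z` has mean `d / (d + 1)`, one step contracts Lipschitz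
constants for `|ρ (x - a) - ρ (y - a)|` by the product `β` of the two means.

The passage from this Wasserstein-type contraction to `L₂` uses reversibility. For `T = P - π`, mean
zero bounds the `L₂` norm by the Lipschitz constant, once `ρ (x - a)` is square integrable (this
needs `m > 2`). Thus the iterates of `T` on bounded Lipschitz functions decay like `β ^ n`, and
log-convexity of `n ↦ ‖T ^ n f‖` for self-adjoint `T` turns this into `‖T f‖ ≤ β * ‖f‖`. Functions
Lipschitz in the gauge distance depend on `x` only through `ρ (x - a)`, so they are not dense in
`L₂`; but the range of `T` lies in their closure, and self-adjointness makes this sufficient. -/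

namespace SliceSampling

/-! ### Symmetric operators: from decay of iterates to a norm bound. -/

section Hilbert

variable {H : Type*} [NormedAddCommGroup H] [InnerProductSpace ℝ H]

/-- Cauchy–Schwarz for `⟪f, T (T f)⟫ = ‖T f‖ ^ 2`; applied along an orbit, this is log-convexity of
the norms. -/
theorem norm_sq_apply_le_of_isSymmetric {T : H →L[ℝ] H}
    (hT : ∀ f g, inner ℝ f (T g) = inner ℝ (T f) g) (f : H) :
    ‖T f‖ ^ 2 ≤ ‖f‖ * ‖T (T f)‖ := by
  rw [← real_inner_self_eq_norm_sq, ← hT]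
  exact real_inner_le_norm _ _

/-- The norms of the iterates of a symmetric operator are log-convex, so a geometric decay of the
iterates at rate `β` gives a one-step contraction with the same rate. -/
theorem norm_apply_le_of_norm_iterate_le {T : H →L[ℝ] H}
    (hT : ∀ f g, inner ℝ f (T g) = inner ℝ (T f) g) {β C : ℝ} (hβ : 0 < β) {f : H}
    (hC : ∀ n : ℕ, ‖T^[n] f‖ ≤ C * β ^ n) : ‖T f‖ ≤ β * ‖f‖ := by
  by_contra! hlt
  -- Log-convexity makes the ratios of consecutive norms nondecreasing, so all of them stay above
  -- `β` and at least as large as the first. The strict inequality also keeps the iterates nonzero.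
  have hstep (n : ℕ) : β * ‖T^[n] f‖ < ‖T^[n + 1] f‖ ∧
      ‖T f‖ * ‖T^[n] f‖ ≤ ‖f‖ * ‖T^[n + 1] f‖ := by
    induction n with
    | zero => exact ⟨by simpa using hlt, by simp [mul_comm]⟩
    | succ n ih =>
      have hlog : ‖T^[n + 1] f‖ ^ 2 ≤ ‖T^[n] f‖ * ‖T^[n + 2] f‖ := by
        have := norm_sq_apply_le_of_isSymmetric hT (T^[n] f)
        simpa only [Function.iterate_succ_apply'] using this
      have hn0 : 0 ≤ ‖T^[n] f‖ := norm_nonneg _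
      have h1 : 0 < ‖T^[n + 1] f‖ := lt_of_le_of_lt (by positivity) ih.1
      have hn : 0 < ‖T^[n] f‖ := by
        rcases hn0.eq_or_lt with h | h
        · rw [← h, zero_mul] at hlog
          nlinarith
        · exact h
      refine ⟨?_, ?_⟩
      · refine lt_of_mul_lt_mul_left ?_ hn0
        nlinarith [mul_lt_mul_of_pos_right ih.1 h1]
      · refine le_of_mul_le_mul_left ?_ hn
        nlinarith [mul_le_mul_of_nonneg_right ih.2 h1.le,
          mul_le_mul_of_nonneg_left hlog (norm_nonneg f)]
  have hTf : 0 < ‖T f‖ := lt_of_le_of_lt (by positivity) hlt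
  have hf : 0 < ‖f‖ := by
    refine norm_pos_iff.2 fun h => ?_
    simp [h] at hTf
  have hgeom (n : ℕ) : (‖T f‖ / ‖f‖) ^ n * ‖f‖ ≤ ‖T^[n] f‖ := by
    induction n with
    | zero => simp
    | succ n ih =>
      have h2 : ‖T f‖ / ‖f‖ * ‖T^[n] f‖ ≤ ‖T^[n + 1] f‖ := by
        rw [div_mul_eq_mul_div, div_le_iff₀ hf, mul_comm _ ‖f‖]
        exact (hstep n).2
      calc _ = ‖T f‖ / ‖f‖ * ((‖T f‖ / ‖f‖) ^ n * ‖f‖) := by ring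
        _ ≤ ‖T f‖ / ‖f‖ * ‖T^[n] f‖ := by gcongr
        _ ≤ _ := h2
  have hq : 1 < ‖T f‖ / ‖f‖ / β := by
    rw [one_lt_div hβ, lt_div_iff₀ hf]
    exact hlt
  obtain ⟨n, hn⟩ := pow_unbounded_of_one_lt (C / ‖f‖) hq
  rw [div_pow, div_lt_div_iff₀ hf (by positivity)] at hn
  linarith [hgeom n, hC n]

/-- A symmetric operator whose range is approximated by vectors along which the iterates decay
at rate `β` has norm at most `β`. -/
theorem norm_apply_le_of_range_subset_closure {T : H →L[ℝ] H}
    (hT : ∀ f g, inner ℝ f (T g) = inner ℝ (T f) g) {β C : ℝ} (hβ : 0 < β)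
    (D : ℝ → Set H) (hD : ∀ L, ∀ f ∈ D L, T f ∈ D (β * L))
    (hC : ∀ L, ∀ f ∈ D L, ‖T f‖ ≤ C * L)
    (hrange : ∀ h, T h ∈ closure (⋃ L, D L)) (h : H) : ‖T h‖ ≤ β * ‖h‖ := by
  have hcore : ∀ f ∈ ⋃ L, D L, ‖T f‖ ≤ β * ‖f‖ := by
    intro f hf
    obtain ⟨L, hL⟩ := Set.mem_iUnion.1 hf
    have hiter (n : ℕ) : T^[n] f ∈ D (β ^ n * L) := by
      induction n with
      | zero => simpa using hL
      | succ n ih =>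
        rw [Function.iterate_succ_apply', pow_succ', mul_assoc]
        exact hD _ _ ih
    -- The bound `hC` controls `T f`, not `f`: the term `n = 0` needs `‖f‖` itself, and the division
    -- by `β` pays for the shift of the index.
    refine norm_apply_le_of_norm_iterate_le hT hβ (C := max ‖f‖ (C * L / β)) fun n => ?_
    cases n with
    | zero => simp
    | succ n =>
      rw [Function.iterate_succ_apply']
      calc _ ≤ C * (β ^ n * L) := hC _ _ (hiter n)
        _ = C * L / β * β ^ (n + 1) := by field_simp; ring
        _ ≤ _ := by gcongr; exact le_max_right _ _
  have hcl : ∀ f ∈ closure (⋃ L, D L), ‖T f‖ ≤ β * ‖f‖ := by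
    refine fun f hf => closure_minimal (t := {f | ‖T f‖ ≤ β * ‖f‖}) hcore ?_ hf
    exact isClosed_le (by fun_prop) (by fun_prop)
  -- The vector `h` need not lie in the closure but `T h` does: `‖T h‖ ^ 2 ≤ ‖h‖ * ‖T (T h)‖ ≤ β *
  -- ‖h‖ * ‖T h‖`.
  have h1 := norm_sq_apply_le_of_isSymmetric hT h
  have h2 := hcl _ (hrange h)
  rcases (norm_nonneg (T h)).eq_or_lt with h0 | h0
  · rw [← h0]; positivity
  · refine le_of_mul_le_mul_left ?_ h0
    nlinarith [mul_le_mul_of_nonneg_left h2 (norm_nonneg h)]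

end Hilbert

/-! ### The operator `P - ν` on `L₂(ν)` for an invariant or reversible kernel. -/

section MarkovOperator

variable {G : Type*} [MeasurableSpace G] {P : Kernel G G} {ν : Measure G}

theorem ae_ae_of_invariant (hinv : P.Invariant ν) {p : G → Prop} (h : ∀ᵐ y ∂ν, p y) :
    ∀ᵐ x ∂ν, ∀ᵐ y ∂P x, p y := by
  rw [← hinv.def] at h
  exact Measure.ae_ae_of_ae_comp h

theorem integral_kernel_ae_eq (hinv : P.Invariant ν) {f g : G → ℝ} (h : f =ᵐ[ν] g) :
    (fun x => ∫ y, f y ∂P x) =ᵐ[ν] fun x => ∫ y, g y ∂P x := by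
  filter_upwards [ae_ae_of_invariant hinv h] with x hx using integral_congr_ae hx

theorem aestronglyMeasurable_integral_kernel (hinv : P.Invariant ν) {f : G → ℝ}
    (hf : AEStronglyMeasurable f ν) : AEStronglyMeasurable (fun x => ∫ y, f y ∂P x) ν :=
  ⟨fun x => ∫ y, hf.mk f y ∂P x, hf.stronglyMeasurable_mk.integral_kernel,
    integral_kernel_ae_eq hinv hf.ae_eq_mk⟩

/-- Jensen under each `P x`, integrated against `ν` by invariance. -/
theorem eLpNorm_integral_kernel_le [IsMarkovKernel P] (hinv : P.Invariant ν) {f : G → ℝ}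
    (hf : AEStronglyMeasurable f ν) :
    eLpNorm (fun x => ∫ y, f y ∂P x) 2 ν ≤ eLpNorm f 2 ν := by
  wlog hfm : StronglyMeasurable f generalizing f
  · rw [eLpNorm_congr_ae (integral_kernel_ae_eq hinv hf.ae_eq_mk), eLpNorm_congr_ae hf.ae_eq_mk]
    exact this hf.stronglyMeasurable_mk.aestronglyMeasurable hf.stronglyMeasurable_mk
  rw [eLpNorm_eq_lintegral_rpow_enorm_toReal two_ne_zero ENNReal.ofNat_ne_top,
    eLpNorm_eq_lintegral_rpow_enorm_toReal two_ne_zero ENNReal.ofNat_ne_top]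
  gcongr ?_ ^ _
  have hmeas : Measurable fun y => ‖f y‖ₑ ^ (2 : ℝ≥0∞).toReal := by
    exact hfm.measurable.enorm.pow_const _
  conv_rhs => rw [← hinv.def]
  rw [Measure.lintegral_bind P.aemeasurable hmeas.aemeasurable]
  refine lintegral_mono fun x => ?_
  have h1 : ‖∫ y, f y ∂P x‖ₑ ≤ eLpNorm f 2 (P x) := by
    refine (enorm_integral_le_lintegral_enorm _).trans ?_
    rw [← eLpNorm_one_eq_lintegral_enorm]
    exact eLpNorm_le_eLpNorm_of_exponent_le (by norm_num) hfm.aestronglyMeasurable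
  calc _ ≤ eLpNorm f 2 (P x) ^ (2 : ℝ≥0∞).toReal := by gcongr
    _ = _ := by
      rw [eLpNorm_eq_lintegral_rpow_enorm_toReal two_ne_zero ENNReal.ofNat_ne_top,
        ← ENNReal.rpow_mul]
      norm_num

theorem memLp_integral_kernel [IsMarkovKernel P] (hinv : P.Invariant ν) {f : G → ℝ}
    (hf : MemLp f 2 ν) : MemLp (fun x => ∫ y, f y ∂P x) 2 ν :=
  ⟨aestronglyMeasurable_integral_kernel hinv hf.1,
    (eLpNorm_integral_kernel_le hinv hf.1).trans_lt hf.2⟩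

theorem ae_integrable_of_invariant (hinv : P.Invariant ν) {f : G → ℝ} (hf : Integrable f ν) :
    ∀ᵐ x ∂ν, Integrable f (P x) := by
  rw [← hinv.def] at hf
  exact Measure.ae_integrable_of_integrable_comp hf

theorem integral_kernel_integral (hinv : P.Invariant ν) {f : G → ℝ}
    (hf : Integrable f ν) :
    ∫ x, ∫ y, f y ∂P x ∂ν = ∫ y, f y ∂ν := by
  have h : (P ∘ₖ Kernel.const Unit ν) () = ν := by
    rw [Kernel.comp_const, Kernel.const_apply, hinv.def]
  rw [← h] at hf
  have := Kernel.integral_comp hf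
  rwa [h, Kernel.const_apply, eq_comm] at this

theorem eLpNorm_two_le_of_norm_toLp_le {f g : G → ℝ} (hf : MemLp f 2 ν) (hg : MemLp g 2 ν)
    {c : ℝ} (hc : 0 ≤ c) (h : ‖hf.toLp f‖ ≤ c * ‖hg.toLp g‖) :
    eLpNorm f 2 ν ≤ ENNReal.ofReal c * eLpNorm g 2 ν := by
  rw [Lp.norm_toLp, Lp.norm_toLp] at h
  rw [← ENNReal.toReal_le_toReal hf.2.ne (ENNReal.mul_ne_top ENNReal.ofReal_ne_top hg.2.ne),
    ENNReal.toReal_mul, ENNReal.toReal_ofReal hc]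
  exact h

theorem le_spectralGap_of_opNormSub_le {β : ℝ} (hβ : 0 ≤ β)
    (h : opNormSub P ν ≤ ENNReal.ofReal β) : ((1 - β : ℝ) : EReal) ≤ spectralGap P ν := by
  rw [spectralGap, EReal.coe_sub, EReal.coe_one]
  refine EReal.sub_le_sub le_rfl ?_
  calc (opNormSub P ν : EReal) ≤ (ENNReal.ofReal β : EReal) := by exact_mod_cast h
    _ = β := by rw [EReal.coe_ennreal_ofReal, max_eq_left hβ]

variable [IsProbabilityMeasure ν] [IsMarkovKernel P]

theorem memLp_centered (hinv : P.Invariant ν) {f : G → ℝ} (hf : MemLp f 2 ν) :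
    MemLp (fun x => (∫ y, f y ∂P x) - ∫ y, f y ∂ν) 2 ν :=
  (memLp_integral_kernel hinv hf).sub (memLp_const _)

/-- The operator `P - ν` on `L₂(ν)`, as a linear map. -/
noncomputable def centeredLinearMap (hinv : P.Invariant ν) : Lp ℝ 2 ν →ₗ[ℝ] Lp ℝ 2 ν where
  toFun f := (memLp_centered hinv (Lp.memLp f)).toLp _
  map_add' f g := by
    rw [← MemLp.toLp_add]
    refine MemLp.toLp_congr _ _ ?_
    have hf := (Lp.memLp f).integrable one_le_two
    have hg := (Lp.memLp g).integrable one_le_two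
    have h := Lp.coeFn_add f g
    filter_upwards [integral_kernel_ae_eq hinv h, ae_integrable_of_invariant hinv hf,
      ae_integrable_of_invariant hinv hg] with x hx hfx hgx
    rw [hx, integral_congr_ae h]
    simp only [Pi.add_apply]
    rw [integral_add hfx hgx, integral_add hf hg]
    ring
  map_smul' c f := by
    rw [RingHom.id_apply, ← MemLp.toLp_const_smul]
    refine MemLp.toLp_congr _ _ ?_
    have h := Lp.coeFn_smul c f
    filter_upwards [integral_kernel_ae_eq hinv h] with x hx
    rw [hx, integral_congr_ae h]
    simp only [Pi.smul_apply, smul_eq_mul]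
    rw [integral_const_mul, integral_const_mul]
    ring

/-- The crude constant 2, from estimating `P` and `ν` separately, serves only for continuity. -/
theorem norm_centeredLinearMap_le (hinv : P.Invariant ν) (f : Lp ℝ 2 ν) :
    ‖centeredLinearMap hinv f‖ ≤ 2 * ‖f‖ := by
  have hf := Lp.memLp f
  have h1 : eLpNorm (fun x => (∫ y, f y ∂P x) - ∫ y, f y ∂ν) 2 ν ≤ 2 * eLpNorm f 2 ν := by
    refine (eLpNorm_sub_le (memLp_integral_kernel hinv hf).1 aestronglyMeasurable_const
      one_le_two).trans ?_
    rw [two_mul]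
    refine add_le_add (eLpNorm_integral_kernel_le hinv hf.1) ?_
    rw [eLpNorm_const _ two_ne_zero (NeZero.ne ν)]
    simp only [measure_univ, ENNReal.one_rpow, mul_one]
    refine (enorm_integral_le_lintegral_enorm _).trans ?_
    rw [← eLpNorm_one_eq_lintegral_enorm]
    exact eLpNorm_le_eLpNorm_of_exponent_le (by norm_num) hf.1
  change ‖(memLp_centered hinv hf).toLp _‖ ≤ _
  rw [Lp.norm_toLp, Lp.norm_def, ← ENNReal.toReal_ofNat 2, ← ENNReal.toReal_mul]
  exact ENNReal.toReal_mono (ENNReal.mul_ne_top ENNReal.ofNat_ne_top hf.2.ne) h1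

/-- The operator `P - ν` on `L₂(ν)`. -/
noncomputable def centeredOp (hinv : P.Invariant ν) : Lp ℝ 2 ν →L[ℝ] Lp ℝ 2 ν :=
  (centeredLinearMap hinv).mkContinuous 2 (norm_centeredLinearMap_le hinv)

theorem centeredOp_apply (hinv : P.Invariant ν) (f : Lp ℝ 2 ν) :
    centeredOp hinv f = (memLp_centered hinv (Lp.memLp f)).toLp _ := rfl

theorem centeredOp_toLp (hinv : P.Invariant ν) {f : G → ℝ} (hf : MemLp f 2 ν) :
    centeredOp hinv (hf.toLp f) = (memLp_centered hinv hf).toLp _ := by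
  rw [centeredOp_apply]
  refine MemLp.toLp_congr _ _ ?_
  filter_upwards [integral_kernel_ae_eq hinv hf.coeFn_toLp] with x hx
  rw [hx, integral_congr_ae hf.coeFn_toLp]

theorem IsReversible.map_swap_compProd (hrev : P.IsReversible ν) :
    (ν ⊗ₘ P).map Prod.swap = ν ⊗ₘ P := by
  refine Measure.ext_prod fun {s t} hs ht => ?_
  rw [Measure.map_apply measurable_swap (hs.prod ht), Set.preimage_swap_prod,
    Measure.compProd_apply_prod ht hs, Measure.compProd_apply_prod hs ht]
  exact hrev ht hs

/-- Both sides integrate a product of functions of the two coordinates against `ν ⊗ₘ P`, which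
reversibility makes invariant under the swap. -/
theorem integral_mul_integral_kernel_comm (hrev : P.IsReversible ν) {f g : G → ℝ}
    (hf : MemLp f 2 ν) (hg : MemLp g 2 ν) :
    ∫ x, f x * ∫ y, g y ∂P x ∂ν = ∫ x, (∫ y, f y ∂P x) * g x ∂ν := by
  have hsnd : (ν ⊗ₘ P).snd = ν := by rw [Measure.snd_compProd]; exact hrev.invariant.def
  have hfst : (ν ⊗ₘ P).fst = ν := Measure.fst_compProd ν P
  have h1 {f : G → ℝ} (hf : MemLp f 2 ν) : MemLp (fun p : G × G => f p.1) 2 (ν ⊗ₘ P) := by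
    rw [← hfst] at hf
    exact hf.comp_measurePreserving ⟨measurable_fst, rfl⟩
  have h2 {f : G → ℝ} (hf : MemLp f 2 ν) : MemLp (fun p : G × G => f p.2) 2 (ν ⊗ₘ P) := by
    rw [← hsnd] at hf
    exact hf.comp_measurePreserving ⟨measurable_snd, rfl⟩
  have h3 {f g : G → ℝ} (hf : MemLp f 2 ν) (hg : MemLp g 2 ν) :
      ∫ x, f x * ∫ y, g y ∂P x ∂ν = ∫ p, f p.1 * g p.2 ∂(ν ⊗ₘ P) := by
    have hint : Integrable (fun p : G × G => f p.1 * g p.2) (ν ⊗ₘ P) :=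
      (h1 hf).integrable_mul (h2 hg)
    rw [Measure.integral_compProd hint]
    simp only [integral_const_mul]
  rw [h3 hf hg]
  have h4 : ∫ x, (∫ y, f y ∂P x) * g x ∂ν = ∫ x, g x * ∫ y, f y ∂P x ∂ν := by
    simp only [mul_comm]
  rw [h4, h3 hg hf]
  conv_rhs => rw [← IsReversible.map_swap_compProd hrev]
  simp only [mul_comm (f _)]
  exact (integral_map_equiv (μ := ν ⊗ₘ P) MeasurableEquiv.prodComm
    fun p : G × G => g p.1 * f p.2).symm

theorem inner_centeredOp (hrev : P.IsReversible ν) (f g : Lp ℝ 2 ν) :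
    inner ℝ f (centeredOp hrev.invariant g) = inner ℝ (centeredOp hrev.invariant f) g := by
  have hf := Lp.memLp f
  have hg := Lp.memLp g
  have hPf := memLp_integral_kernel hrev.invariant hf
  have hPg := memLp_integral_kernel hrev.invariant hg
  rw [L2.inner_def, L2.inner_def]
  have e1 : ∫ a, inner ℝ (f a) (centeredOp hrev.invariant g a) ∂ν
      = ∫ a, (f a * (∫ y, g y ∂P a) - f a * ∫ y, g y ∂ν) ∂ν := by
    refine integral_congr_ae ?_
    filter_upwards [(memLp_centered hrev.invariant hg).coeFn_toLp] with x hx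
    rw [centeredOp_apply, hx, real_inner_eq_re_inner, RCLike.inner_apply]
    simp
    ring
  have e2 : ∫ a, inner ℝ (centeredOp hrev.invariant f a) (g a) ∂ν
      = ∫ a, ((∫ y, f y ∂P a) * g a - (∫ y, f y ∂ν) * g a) ∂ν := by
    refine integral_congr_ae ?_
    filter_upwards [(memLp_centered hrev.invariant hf).coeFn_toLp] with x hx
    rw [centeredOp_apply, hx, real_inner_eq_re_inner, RCLike.inner_apply]
    simp
    ring
  have i1 : Integrable (fun a => f a * ∫ y, g y ∂P a) ν := hf.integrable_mul hPg
  have i2 : Integrable (fun a => (∫ y, f y ∂P a) * g a) ν := hPf.integrable_mul hg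
  rw [e1, e2, integral_sub i1 ((hf.integrable one_le_two).mul_const _),
    integral_sub i2 ((hg.integrable one_le_two).const_mul _),
    integral_mul_integral_kernel_comm hrev hf hg, integral_mul_const, integral_const_mul]

theorem opNormSub_le (hinv : P.Invariant ν) {β : ℝ} (hβ : 0 ≤ β)
    (h : ∀ f : Lp ℝ 2 ν, ‖centeredOp hinv f‖ ≤ β * ‖f‖) : opNormSub P ν ≤ ENNReal.ofReal β := by
  refine iSup_le fun g => iSup_le fun hg => iSup_le fun hg1 => ?_
  have := h (hg.toLp g)
  rw [centeredOp_toLp] at this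
  calc _ ≤ ENNReal.ofReal β * eLpNorm g 2 ν := eLpNorm_two_le_of_norm_toLp_le _ hg hβ this
    _ ≤ ENNReal.ofReal β * 1 := by gcongr
    _ = _ := mul_one _

end MarkovOperator

end SliceSampling

/-! ### Uniform slice sampling: Markov property, reversibility, rescaled levels. -/

namespace SliceSampling

/-- The kernel sampling uniformly from the interval `(0, s)`. -/
noncomputable def uniformIooKernel : Kernel ℝ ℝ where
  toFun s := (volume : Measure ℝ)[|Set.Ioo 0 s]
  measurable' := by
    refine Measure.measurable_of_measurable_coe _ fun s hs => ?_
    have hS : MeasurableSet {p : ℝ × ℝ | (0 < p.2 ∧ p.2 < p.1) ∧ p.2 ∈ s} :=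
      ((measurableSet_lt measurable_const measurable_snd).inter
        (measurableSet_lt measurable_snd measurable_fst)).inter (measurable_snd hs)
    simp only [cond_apply measurableSet_Ioo, Real.volume_Ioo, sub_zero]
    exact measurable_id.ennreal_ofReal.inv.mul (measurable_measure_prodMk_left (ν := volume) hS)

section USS

variable {d : ℕ} {ϱ : EuclideanSpace ℝ (Fin d) → ℝ} (hϱ : Measurable ϱ)

/-- The transition law sees the state only through its density value; this later places the range of
`P - π` among functions of the gauge. -/
theorem ussKernel_apply_eq (x : EuclideanSpace ℝ (Fin d)) :
    ussKernel ϱ hϱ x = (sliceKernel ϱ hϱ ∘ₖ uniformIooKernel) (ϱ x) := by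
  rw [ussKernel, Kernel.comp_apply, Kernel.comp_apply]
  rfl

theorem sliceKernel_apply' (t : ℝ) {B : Set (EuclideanSpace ℝ (Fin d))} :
    sliceKernel ϱ hϱ t B = (volume {x | t < ϱ x})⁻¹ * volume ({x | t < ϱ x} ∩ B) :=
  cond_apply (measurableSet_lt measurable_const hϱ) _ _

theorem lintegral_thresholdKernel (x : EuclideanSpace ℝ (Fin d)) (f : ℝ → ℝ≥0∞) :
    ∫⁻ t, f t ∂(thresholdKernel ϱ hϱ x) =
      (ENNReal.ofReal (ϱ x))⁻¹ * ∫⁻ t in Set.Ioo 0 (ϱ x), f t := by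
  change ∫⁻ t, f t ∂((volume : Measure ℝ)[|Set.Ioo 0 (ϱ x)]) = _
  rw [ProbabilityTheory.cond, lintegral_smul_measure, Real.volume_Ioo, sub_zero, smul_eq_mul]

/-- Not Markov in general: on a slice of zero or infinite volume, conditioning returns the zero
measure. -/
instance : IsFiniteKernel (sliceKernel ϱ hϱ) :=
  ⟨1, ENNReal.one_lt_top, fun t =>
    (prob_le_one : (volume : Measure (EuclideanSpace ℝ (Fin d)))[|{x | t < ϱ x}] Set.univ ≤ 1)⟩

theorem ussKernel_apply' (x : EuclideanSpace ℝ (Fin d)) {B : Set (EuclideanSpace ℝ (Fin d))}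
    (hB : MeasurableSet B) :
    ussKernel ϱ hϱ x B =
      (ENNReal.ofReal (ϱ x))⁻¹ * ∫⁻ t in Set.Ioo 0 (ϱ x), sliceKernel ϱ hϱ t B := by
  rw [ussKernel, Kernel.comp_apply' _ _ _ hB, lintegral_thresholdKernel]

theorem isMarkovKernel_ussKernel (hpos : ∀ x, 0 < ϱ x)
    (hslice : ∀ x, ∀ t ∈ Set.Ioo 0 (ϱ x), volume {y | t < ϱ y} ≠ 0 ∧ volume {y | t < ϱ y} ≠ ∞) :
    IsMarkovKernel (ussKernel ϱ hϱ) := by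
  refine ⟨fun x => ⟨?_⟩⟩
  rw [ussKernel_apply' hϱ x .univ, setLIntegral_congr_fun (g := fun _ => 1) measurableSet_Ioo]
  · rw [setLIntegral_one, Real.volume_Ioo, sub_zero]
    exact ENNReal.inv_mul_cancel (by simpa using hpos x) ENNReal.ofReal_ne_top
  · intro t ht
    simp only [sliceKernel_apply', Set.inter_univ]
    exact ENNReal.inv_mul_cancel (hslice x t ht).1 (hslice x t ht).2

/-- The factor `ϱ x` cancels the normalization of the threshold law, and Tonelli exchanges state and
level. The result is symmetric in `A` and `B`, which is reversibility. -/
theorem setLIntegral_ussKernel (hpos : ∀ x, 0 < ϱ x) (A : Set (EuclideanSpace ℝ (Fin d)))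
    {B : Set (EuclideanSpace ℝ (Fin d))}
    (hB : MeasurableSet B) :
    ∫⁻ x in A, ENNReal.ofReal (ϱ x) * ussKernel ϱ hϱ x B =
      ∫⁻ t in Set.Ioi 0, volume ({x | t < ϱ x} ∩ A) *
        ((volume {x | t < ϱ x})⁻¹ * volume ({x | t < ϱ x} ∩ B)) := by
  have hm : Measurable fun p : EuclideanSpace ℝ (Fin d) × ℝ =>
      ({p | p.2 < ϱ p.1}.indicator (fun p => sliceKernel ϱ hϱ p.2 B) p) :=
    ((Kernel.measurable_coe (sliceKernel ϱ hϱ) hB).comp measurable_snd).indicator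
      (measurableSet_lt measurable_snd (hϱ.comp measurable_fst))
  calc _ = ∫⁻ x in A, ∫⁻ t in Set.Ioi 0,
        {p : EuclideanSpace ℝ (Fin d) × ℝ | p.2 < ϱ p.1}.indicator
          (fun p => sliceKernel ϱ hϱ p.2 B) (x, t) := by
        refine lintegral_congr fun x => ?_
        rw [ussKernel_apply' hϱ x hB, ← mul_assoc,
          ENNReal.mul_inv_cancel (by simpa using hpos x) ENNReal.ofReal_ne_top, one_mul,
          ← Set.Ioi_inter_Iio, Set.inter_comm, ← setLIntegral_indicator measurableSet_Iio]
        rfl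
    _ = ∫⁻ t in Set.Ioi 0, ∫⁻ x in A,
        {p : EuclideanSpace ℝ (Fin d) × ℝ | p.2 < ϱ p.1}.indicator
          (fun p => sliceKernel ϱ hϱ p.2 B) (x, t) :=
        lintegral_lintegral_swap hm.aemeasurable
    _ = _ := by
        refine lintegral_congr fun t => ?_
        rw [← sliceKernel_apply' hϱ, mul_comm, ← setLIntegral_const,
          ← setLIntegral_indicator (measurableSet_lt measurable_const hϱ)]
        rfl

theorem isReversible_ussKernel (hpos : ∀ x, 0 < ϱ x) :
    (ussKernel ϱ hϱ).IsReversible (densityMeasure ϱ) := by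
  intro A B hA hB
  have key {A B : Set (EuclideanSpace ℝ (Fin d))} (hA : MeasurableSet A) (hB : MeasurableSet B) :
      ∫⁻ x in A, ussKernel ϱ hϱ x B ∂(densityMeasure ϱ) =
        (∫⁻ x, ENNReal.ofReal (ϱ x))⁻¹ * ∫⁻ t in Set.Ioi 0, volume ({x | t < ϱ x} ∩ A) *
          ((volume {x | t < ϱ x})⁻¹ * volume ({x | t < ϱ x} ∩ B)) := by
    rw [densityMeasure, Measure.restrict_smul, lintegral_smul_measure,
      restrict_withDensity hA, lintegral_withDensity_eq_lintegral_mul _ hϱ.ennreal_ofReal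
        (Kernel.measurable_coe _ hB), ← setLIntegral_ussKernel hϱ hpos A hB]
    rfl
  rw [key hA hB, key hB hA]
  congr 1
  refine lintegral_congr fun t => ?_
  ring

theorem isProbabilityMeasure_densityMeasure (h0 : ∫⁻ x, ENNReal.ofReal (ϱ x) ≠ 0)
    (h1 : ∫⁻ x, ENNReal.ofReal (ϱ x) ≠ ∞) : IsProbabilityMeasure (densityMeasure ϱ) := by
  refine ⟨?_⟩
  rw [densityMeasure, Measure.smul_apply, withDensity_apply _ .univ, Measure.restrict_univ,
    smul_eq_mul]
  exact ENNReal.inv_mul_cancel h0 h1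

/-- Substituting `t = u * ϱ x` expresses all starting points with one uniform variable `u`: the
first half of the coupling. -/
theorem integral_ussKernel [IsMarkovKernel (ussKernel ϱ hϱ)]
    {f : EuclideanSpace ℝ (Fin d) → ℝ} (hf : Measurable f) {C : ℝ} (hC : ∀ x, |f x| ≤ C)
    {x : EuclideanSpace ℝ (Fin d)} (hx : 0 < ϱ x) :
    ∫ y, f y ∂(ussKernel ϱ hϱ x) =
      ∫ u in Set.Ioo (0 : ℝ) 1, ∫ y, f y ∂(sliceKernel ϱ hϱ (u * ϱ x)) := by
  have hint : Integrable f (ussKernel ϱ hϱ x) :=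
    Integrable.of_bound hf.aestronglyMeasurable C (Filter.Eventually.of_forall hC)
  rw [ussKernel] at hint ⊢
  rw [Kernel.integral_comp hint]
  change ∫ t, _ ∂((volume : Measure ℝ)[|Set.Ioo 0 (ϱ x)]) = _
  rw [ProbabilityTheory.cond, integral_smul_measure, Real.volume_Ioo, sub_zero,
    ENNReal.toReal_inv, ENNReal.toReal_ofReal hx.le, ← integral_Ioc_eq_integral_Ioo,
    ← integral_Ioc_eq_integral_Ioo, ← intervalIntegral.integral_of_le hx.le,
    ← intervalIntegral.integral_of_le zero_le_one]
  have := intervalIntegral.integral_comp_mul_right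
    (fun t => ∫ y, f y ∂(sliceKernel ϱ hϱ t)) hx.ne' (a := 0) (b := 1)
  rw [this, zero_mul, one_mul]

end USS

end SliceSampling

/-! ### The radial profile and its slice radii. -/

namespace SliceSampling

section Radial

/-- The reverse triangle inequality in the plane for the points `(a, √c)` and `(b, √c)`. -/
theorem abs_sqrt_sq_add_sub_le (a b : ℝ) {c : ℝ} (hc : 0 ≤ c) :
    |√(a ^ 2 + c) - √(b ^ 2 + c)| ≤ |a - b| := by
  have key (a b : ℝ) : √(a ^ 2 + c) ≤ |a - b| + √(b ^ 2 + c) := by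
    have hb : |b| ≤ √(b ^ 2 + c) := Real.abs_le_sqrt (by linarith)
    have hs : √(b ^ 2 + c) ^ 2 = b ^ 2 + c := Real.sq_sqrt (by positivity)
    rw [Real.sqrt_le_left (by positivity)]
    have h1 : (a - b) * b ≤ |a - b| * √(b ^ 2 + c) :=
      (le_abs_self _).trans (by rw [abs_mul]; gcongr)
    nlinarith [sq_abs (a - b)]
  rw [abs_sub_le_iff]
  constructor
  · linarith [key a b]
  · have := key b a
    rw [abs_sub_comm] at this
    linarith

/-- The radius of the slice of `s ↦ (1 + s ^ 2) ^ (-p / 2)` at the level `t`. -/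
noncomputable def sliceRadius (p t : ℝ) : ℝ := √(t ^ (-2 / p) - 1)

theorem one_lt_rpow_neg_two_div {p t : ℝ} (hp : 0 < p) (h0 : 0 < t) (h1 : t < 1) :
    1 < t ^ (-2 / p) :=
  Real.one_lt_rpow_of_pos_of_lt_one_of_neg h0 h1 (div_neg_of_neg_of_pos (by norm_num) hp)

theorem sliceRadius_pos {p t : ℝ} (hp : 0 < p) (h0 : 0 < t) (h1 : t < 1) :
    0 < sliceRadius p t :=
  Real.sqrt_pos.2 (by linarith [one_lt_rpow_neg_two_div hp h0 h1])

theorem lt_radial_iff {p t s : ℝ} (hp : 0 < p) (h0 : 0 < t) (hs : 0 ≤ s) :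
    t < (1 + s ^ 2) ^ (-p / 2) ↔ s < sliceRadius p t := by
  have hpos : 0 < 1 + s ^ 2 := by positivity
  have h : -p / 2 = (-2 / p)⁻¹ := by field_simp
  rw [h, Real.lt_rpow_inv_iff_of_neg h0 hpos (div_neg_of_neg_of_pos (by norm_num) hp),
    sliceRadius, Real.lt_sqrt hs, lt_sub_iff_add_lt']

theorem radial_pos (p s : ℝ) : 0 < (1 + s ^ 2) ^ (-p / 2) := by positivity

theorem radial_le_one {p : ℝ} (hp : 0 ≤ p) (s : ℝ) : (1 + s ^ 2) ^ (-p / 2) ≤ 1 :=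
  Real.rpow_le_one_of_one_le_of_nonpos (by nlinarith [sq_nonneg s]) (by linarith)

theorem sliceRadius_mul_radial {p u : ℝ} (hp : 0 < p) (hu : 0 < u) (s : ℝ) :
    sliceRadius p (u * (1 + s ^ 2) ^ (-p / 2)) =
      √((u ^ (-1 / p) * s) ^ 2 + ((u ^ (-1 / p)) ^ 2 - 1)) := by
  have hpos : 0 < 1 + s ^ 2 := by positivity
  have h2 : (u ^ (-1 / p)) ^ 2 = u ^ (-2 / p) := by
    rw [← Real.rpow_mul_natCast hu.le]
    congr 1
    push_cast
    ring
  rw [sliceRadius, Real.mul_rpow hu.le (radial_pos p s).le, ← Real.rpow_mul hpos.le,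
    mul_pow, h2]
  have : -p / 2 * (-2 / p) = 1 := by field_simp
  rw [this, Real.rpow_one]
  congr 1
  ring

/-- For `u ≤ 1` the additive constant `u ^ (-2/p) - 1` under the root is nonnegative, so only the
dilation by `u ^ (-1/p)` counts. -/
theorem abs_sliceRadius_sub_le {p u : ℝ} (hp : 0 < p) (hu : 0 < u) (hu1 : u ≤ 1) (s s' : ℝ) :
    |sliceRadius p (u * (1 + s ^ 2) ^ (-p / 2)) - sliceRadius p (u * (1 + s' ^ 2) ^ (-p / 2))| ≤
      u ^ (-1 / p) * |s - s'| := by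
  rw [sliceRadius_mul_radial hp hu, sliceRadius_mul_radial hp hu]
  have h1 : 1 ≤ u ^ (-1 / p) := Real.one_le_rpow_of_pos_of_le_one_of_nonpos hu hu1
    (div_nonpos_of_nonpos_of_nonneg (by norm_num) hp.le)
  refine (abs_sqrt_sq_add_sub_le _ _ (by nlinarith)).trans ?_
  rw [← mul_sub, abs_mul, abs_of_pos (by linarith)]

theorem integral_rpow_neg_inv {p : ℝ} (hp : 1 < p) :
    IntegrableOn (fun u : ℝ => u ^ (-1 / p)) (Set.Ioo 0 1) ∧
      ∫ u in Set.Ioo (0 : ℝ) 1, u ^ (-1 / p) = p / (p - 1) := by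
  have h : -1 < -1 / p := by
    rw [lt_div_iff₀ (by linarith)]
    linarith
  have hp1 : p - 1 ≠ 0 := by linarith
  constructor
  · have := intervalIntegral.intervalIntegrable_rpow' h (a := 0) (b := 1)
    rw [intervalIntegrable_iff_integrableOn_Ioo_of_le zero_le_one] at this
    exact this
  · rw [← integral_Ioc_eq_integral_Ioo, ← intervalIntegral.integral_of_le zero_le_one,
      integral_rpow (Or.inl h), Real.one_rpow, Real.zero_rpow (by linarith)]
    have : -1 / p + 1 = (p - 1) / p := by field_simp; ring
    rw [this, sub_zero, one_div_div]

end Radial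

/-- A measurable, nonnegative and positively homogeneous function whose unit ball has finite
volume. -/
structure IsGauge {d : ℕ} (ρ : EuclideanSpace ℝ (Fin d) → ℝ) : Prop where
  measurable : Measurable ρ
  nonneg : ∀ x, 0 ≤ ρ x
  smul : ∀ c : ℝ, 0 < c → ∀ x, ρ (c • x) = c * ρ x
  volume_ne_top : volume {x | ρ x < 1} ≠ ∞

/-! ### Gauge balls, their uniform distributions, and integrability. -/

namespace IsGauge

variable {d : ℕ} {ρ : EuclideanSpace ℝ (Fin d) → ℝ}

theorem volume_preimage_affine (a : EuclideanSpace ℝ (Fin d)) {R : ℝ} (hR : 0 < R)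
    (C : Set (EuclideanSpace ℝ (Fin d))) :
    volume ((fun z => a + R • z) ⁻¹' C) = (ENNReal.ofReal (R ^ d))⁻¹ * volume C := by
  have : (fun z => a + R • z) ⁻¹' C = (R • ·) ⁻¹' ((fun z => a + z) ⁻¹' C) := rfl
  rw [this, Measure.addHaar_preimage_smul _ hR.ne', measure_preimage_add,
    finrank_euclideanSpace_fin, abs_of_pos (by positivity), ENNReal.ofReal_inv_of_pos (by positivity)]

theorem preimage_affine_ball (hρ : IsGauge ρ) (a : EuclideanSpace ℝ (Fin d)) {R : ℝ}
    (hR : 0 < R) : (fun z => a + R • z) ⁻¹' {y | ρ (y - a) < R} = {z | ρ z < 1} := by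
  ext z
  simp only [Set.mem_preimage, Set.mem_ofPred_eq, add_sub_cancel_left, hρ.smul R hR]
  exact mul_lt_iff_lt_one_right hR

theorem volume_ball (hρ : IsGauge ρ) (a : EuclideanSpace ℝ (Fin d)) {R : ℝ} (hR : 0 < R) :
    volume {y | ρ (y - a) < R} = ENNReal.ofReal (R ^ d) * volume {z | ρ z < 1} := by
  rw [← hρ.preimage_affine_ball a hR, volume_preimage_affine a hR, ← mul_assoc,
    ENNReal.mul_inv_cancel (by simpa using pow_pos hR d) ENNReal.ofReal_ne_top, one_mul]

/-- The dilates of the unit ball cover the space, and scaling would make them all null. -/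
theorem volume_unitBall_ne_zero (hρ : IsGauge ρ) : volume {z | ρ z < 1} ≠ 0 := by
  intro h
  have hU : (⋃ n : ℕ, {y | ρ (y - 0) < (n : ℝ) + 1}) = Set.univ := by
    refine Set.eq_univ_of_forall fun x => Set.mem_iUnion.2 ?_
    obtain ⟨n, hn⟩ := exists_nat_gt (ρ (x - 0))
    exact ⟨n, hn.trans (lt_add_one _)⟩
  have : volume (⋃ n : ℕ, {y | ρ (y - 0) < (n : ℝ) + 1}) = 0 := by
    refine measure_iUnion_null fun n => ?_
    rw [hρ.volume_ball 0 (by positivity), h, mul_zero]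
  rw [hU] at this
  exact NeZero.ne (volume : Measure (EuclideanSpace ℝ (Fin d))) (Measure.measure_univ_eq_zero.1 this)

theorem volume_ball_ne_zero (hρ : IsGauge ρ) (a : EuclideanSpace ℝ (Fin d)) {R : ℝ}
    (hR : 0 < R) : volume {y | ρ (y - a) < R} ≠ 0 := by
  rw [hρ.volume_ball a hR]
  exact mul_ne_zero (by simpa using pow_pos hR d) hρ.volume_unitBall_ne_zero

theorem volume_ball_ne_top (hρ : IsGauge ρ) (a : EuclideanSpace ℝ (Fin d)) {R : ℝ}
    (hR : 0 < R) : volume {y | ρ (y - a) < R} ≠ ∞ := by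
  rw [hρ.volume_ball a hR]
  exact ENNReal.mul_ne_top ENNReal.ofReal_ne_top hρ.volume_ne_top

/-- The uniform distribution on the unit ball of a gauge. -/
noncomputable def unitBallMeasure (ρ : EuclideanSpace ℝ (Fin d) → ℝ) :
    Measure (EuclideanSpace ℝ (Fin d)) := volume[|{z | ρ z < 1}]

theorem isProbabilityMeasure_unitBallMeasure (hρ : IsGauge ρ) :
    IsProbabilityMeasure (unitBallMeasure ρ) :=
  cond_isProbabilityMeasure_of_finite hρ.volume_unitBall_ne_zero hρ.volume_ne_top

theorem measurableSet_ball (hρ : IsGauge ρ) (a : EuclideanSpace ℝ (Fin d)) (R : ℝ) :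
    MeasurableSet {y | ρ (y - a) < R} :=
  measurableSet_lt (hρ.measurable.comp (measurable_id.sub_const a)) measurable_const

theorem measurableSet_unitBall (hρ : IsGauge ρ) : MeasurableSet {y | ρ y < 1} :=
  measurableSet_lt hρ.measurable measurable_const

/-- One uniform point of the unit ball produces uniform points of all balls at once: the second half
of the coupling. -/
theorem cond_ball_eq_map (hρ : IsGauge ρ) (a : EuclideanSpace ℝ (Fin d)) {R : ℝ} (hR : 0 < R) :
    (volume : Measure (EuclideanSpace ℝ (Fin d)))[|{y | ρ (y - a) < R}] =
      (unitBallMeasure ρ).map (fun z => a + R • z) := by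
  ext B hB
  have hc0 : ENNReal.ofReal (R ^ d) ≠ 0 := by simpa using pow_pos hR d
  have hc1 : ENNReal.ofReal (R ^ d) ≠ ∞ := ENNReal.ofReal_ne_top
  rw [Measure.map_apply (by fun_prop) hB, unitBallMeasure, cond_apply hρ.measurableSet_unitBall,
    cond_apply (hρ.measurableSet_ball a R), ← hρ.preimage_affine_ball a hR, ← Set.preimage_inter,
    volume_preimage_affine a hR, volume_preimage_affine a hR,
    ENNReal.mul_inv (Or.inl (ENNReal.inv_ne_zero.2 hc1))
      (Or.inl (ENNReal.inv_ne_top.2 hc0)), inv_inv]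
  rw [mul_mul_mul_comm, ENNReal.mul_inv_cancel hc0 hc1, one_mul]

theorem unitBallMeasure_ball (hρ : IsGauge ρ) {t : ℝ} (h0 : 0 < t) (h1 : t ≤ 1) :
    (unitBallMeasure ρ).real {z | ρ z < t} = t ^ d := by
  have h : {z | ρ z < 1} ∩ {z | ρ z < t} = {z | ρ (z - 0) < t} := by
    ext z
    simp only [Set.mem_inter_iff, Set.mem_ofPred_eq, sub_zero]
    exact ⟨fun h => h.2, fun h => ⟨h.trans_le h1, h⟩⟩
  rw [Measure.real, unitBallMeasure, cond_apply hρ.measurableSet_unitBall, h,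
    hρ.volume_ball 0 h0, mul_left_comm,
    ENNReal.inv_mul_cancel hρ.volume_unitBall_ne_zero hρ.volume_ne_top, mul_one,
    ENNReal.toReal_ofReal (by positivity)]

theorem ae_unitBallMeasure_lt_one (hρ : IsGauge ρ) : ∀ᵐ z ∂(unitBallMeasure ρ), ρ z < 1 :=
  ae_cond_mem hρ.measurableSet_unitBall

theorem integrable_unitBallMeasure (hρ : IsGauge ρ) : Integrable ρ (unitBallMeasure ρ) := by
  have := hρ.isProbabilityMeasure_unitBallMeasure
  refine Integrable.of_bound hρ.measurable.aestronglyMeasurable 1 ?_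
  filter_upwards [hρ.ae_unitBallMeasure_lt_one] with z hz
  rw [Real.norm_of_nonneg (hρ.nonneg z)]
  exact hz.le

/-- The tail of `ρ` at `t` is `1 - t ^ d`, with integral `1 - 1 / (d + 1)` over `(0, 1]`. -/
theorem integral_unitBallMeasure (hρ : IsGauge ρ) :
    ∫ z, ρ z ∂(unitBallMeasure ρ) = d / (d + 1) := by
  have := hρ.isProbabilityMeasure_unitBallMeasure
  rw [hρ.integrable_unitBallMeasure.integral_eq_integral_Ioc_meas_le (M := 1)
    (Filter.Eventually.of_forall hρ.nonneg)
    (hρ.ae_unitBallMeasure_lt_one.mono fun z hz => hz.le)]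
  have h : ∀ t ∈ Set.Ioc (0 : ℝ) 1, (unitBallMeasure ρ).real {z | t ≤ ρ z} = 1 - t ^ d := by
    intro t ht
    rw [← hρ.unitBallMeasure_ball ht.1 ht.2,
      ← probReal_compl_eq_one_sub (measurableSet_lt hρ.measurable measurable_const)]
    congr 1
    ext z
    simp
  rw [setIntegral_congr_fun measurableSet_Ioc h, ← intervalIntegral.integral_of_le zero_le_one,
    intervalIntegral.integral_sub (by simp)
      (intervalIntegral.intervalIntegrable_pow d), integral_pow]
  simp
  field_simp
  ring

theorem lintegral_radial_ne_top (hρ : IsGauge ρ) (a : EuclideanSpace ℝ (Fin d)) {p : ℝ}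
    (hp : d < p) : ∫⁻ x, ENNReal.ofReal ((1 + ρ (x - a) ^ 2) ^ (-p / 2)) ≠ ∞ := by
  have hp0 : 0 < p := lt_of_le_of_lt (Nat.cast_nonneg d) hp
  have hma : Measurable fun x => ρ (x - a) := hρ.measurable.comp (measurable_id.sub_const a)
  rw [lintegral_eq_lintegral_meas_lt _ (Filter.Eventually.of_forall fun x => (radial_pos _ _).le)
    (((hma.pow_const 2).const_add 1).pow_const _).aemeasurable]
  -- Layer cake: the slice at `t < 1` has radius at most `t ^ (-1/p)`, so its volume is of order at
  -- most `t ^ (-d/p)`, integrable at 0 because `d < p`.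
  have hle : ∀ t ∈ Set.Ioi (0 : ℝ), volume {x | t < (1 + ρ (x - a) ^ 2) ^ (-p / 2)} ≤
      (Set.Ioo (0 : ℝ) 1).indicator
        (fun t => ENNReal.ofReal (t ^ (-d / p)) * volume {z | ρ z < 1}) t := by
    intro t (ht : 0 < t)
    rcases lt_or_ge t 1 with h1 | h1
    · rw [Set.indicator_of_mem (show t ∈ Set.Ioo (0 : ℝ) 1 from ⟨ht, h1⟩)]
      simp only [lt_radial_iff hp0 ht (hρ.nonneg _)]
      rw [hρ.volume_ball a (sliceRadius_pos hp0 ht h1)]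
      gcongr
      have hsq : (t ^ (-1 / p)) ^ 2 = t ^ (-2 / p) := by
        rw [← Real.rpow_mul_natCast ht.le]
        congr 1
        push_cast
        ring
      have : sliceRadius p t ≤ t ^ (-1 / p) := by
        rw [sliceRadius, Real.sqrt_le_left (by positivity), hsq]
        linarith
      calc sliceRadius p t ^ d ≤ (t ^ (-1 / p)) ^ d := by
            gcongr
            exact Real.sqrt_nonneg _
        _ = _ := by
            rw [← Real.rpow_mul_natCast ht.le]
            congr 1
            ring
    · have : {x | t < (1 + ρ (x - a) ^ 2) ^ (-p / 2)} = ∅ := by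
        ext x
        simpa using (radial_le_one hp0.le (ρ (x - a))).trans h1
      simp [this]
  refine ne_top_of_le_ne_top ?_ (setLIntegral_mono' measurableSet_Ioi hle)
  rw [lintegral_indicator measurableSet_Ioo, Measure.restrict_restrict measurableSet_Ioo,
    Set.inter_eq_left.2 (fun t ht => ht.1), lintegral_mul_const' _ _ hρ.volume_ne_top]
  refine ENNReal.mul_ne_top ?_ hρ.volume_ne_top
  have hI : IntegrableOn (fun t : ℝ => t ^ (-(d : ℝ) / p)) (Set.Ioo 0 1) := by
    have h : -1 < -(d : ℝ) / p := by
      rw [lt_div_iff₀ hp0]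
      linarith
    have := intervalIntegral.intervalIntegrable_rpow' h (a := 0) (b := 1)
    rwa [intervalIntegrable_iff_integrableOn_Ioo_of_le zero_le_one] at this
  exact hI.lintegral_lt_top.ne

end IsGauge

end SliceSampling

/-! ### Contraction and spectral gap for densities radial in a gauge. -/

namespace SliceSampling

namespace IsGauge

variable {d : ℕ} {ρ ϱ : EuclideanSpace ℝ (Fin d) → ℝ} {a : EuclideanSpace ℝ (Fin d)} {p : ℝ}

theorem slice_eq (hρ : IsGauge ρ) (hp : 0 < p) (hform : ∀ x, ϱ x = (1 + ρ (x - a) ^ 2) ^ (-p / 2))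
    {t : ℝ} (ht : 0 < t) : {x | t < ϱ x} = {x | ρ (x - a) < sliceRadius p t} := by
  ext x
  simp only [Set.mem_ofPred_eq, hform]
  exact lt_radial_iff hp ht (hρ.nonneg _)

theorem integral_sliceKernel (hρ : IsGauge ρ) (hp : 0 < p) (hϱ : Measurable ϱ)
    (hform : ∀ x, ϱ x = (1 + ρ (x - a) ^ 2) ^ (-p / 2)) {F : EuclideanSpace ℝ (Fin d) → ℝ}
    (hF : Measurable F) {t : ℝ} (h0 : 0 < t) (h1 : t < 1) :
    ∫ y, F y ∂(sliceKernel ϱ hϱ t) = ∫ z, F (a + sliceRadius p t • z) ∂(unitBallMeasure ρ) := by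
  change ∫ y, F y ∂((volume : Measure (EuclideanSpace ℝ (Fin d)))[|{x | t < ϱ x}]) = _
  rw [hρ.slice_eq hp hform h0, hρ.cond_ball_eq_map a (sliceRadius_pos hp h0 h1),
    integral_map (by fun_prop) hF.aestronglyMeasurable]

theorem isMarkovKernel_uss (hρ : IsGauge ρ) (hp : 0 < p) (hϱ : Measurable ϱ)
    (hform : ∀ x, ϱ x = (1 + ρ (x - a) ^ 2) ^ (-p / 2)) : IsMarkovKernel (ussKernel ϱ hϱ) := by
  refine isMarkovKernel_ussKernel hϱ (fun x => by rw [hform]; exact radial_pos _ _) ?_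
  intro x t ht
  have h1 : t < 1 := ht.2.trans_le (by rw [hform]; exact radial_le_one hp.le _)
  have hR := sliceRadius_pos hp ht.1 h1
  rw [hρ.slice_eq hp hform ht.1]
  exact ⟨hρ.volume_ball_ne_zero a hR, hρ.volume_ball_ne_top a hR⟩

theorem isProbabilityMeasure_densityMeasure (hρ : IsGauge ρ) (hp : d < p) (hϱ : Measurable ϱ)
    (hform : ∀ x, ϱ x = (1 + ρ (x - a) ^ 2) ^ (-p / 2)) :
    IsProbabilityMeasure (densityMeasure ϱ) := by
  refine SliceSampling.isProbabilityMeasure_densityMeasure ?_ ?_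
  · rw [Ne, lintegral_eq_zero_iff hϱ.ennreal_ofReal]
    intro h
    obtain ⟨x, hx⟩ := h.exists
    have := radial_pos p (ρ (x - a))
    rw [← hform] at this
    simp only [Pi.zero_apply, ENNReal.ofReal_eq_zero] at hx
    linarith
  · simp only [hform]
    exact hρ.lintegral_radial_ne_top a hp

/-- One step of uniform slice sampling contracts the Lipschitz constant with respect to the
gauge distance. -/
theorem abs_integral_ussKernel_sub_le (hρ : IsGauge ρ) (hp : 1 < p) (hϱ : Measurable ϱ)
    (hform : ∀ x, ϱ x = (1 + ρ (x - a) ^ 2) ^ (-p / 2)) {F : EuclideanSpace ℝ (Fin d) → ℝ}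
    (hF : Measurable F) {B : ℝ} (hB : ∀ x, |F x| ≤ B) {L : ℝ}
    (hL : ∀ x y, |F x - F y| ≤ L * |ρ (x - a) - ρ (y - a)|) (hL0 : 0 ≤ L)
    (x y : EuclideanSpace ℝ (Fin d)) :
    |∫ z, F z ∂(ussKernel ϱ hϱ x) - ∫ z, F z ∂(ussKernel ϱ hϱ y)| ≤
      d / (d + 1) * (p / (p - 1)) * L * |ρ (x - a) - ρ (y - a)| := by
  have hp0 : 0 < p := by linarith
  have := hρ.isMarkovKernel_uss hp0 hϱ hform
  have := hρ.isProbabilityMeasure_unitBallMeasure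
  have hpos (x) : 0 < ϱ x := by rw [hform]; exact radial_pos _ _
  have hle (x) : ϱ x ≤ 1 := by rw [hform]; exact radial_le_one hp0.le _
  have hint (x) : IntegrableOn (fun u => ∫ z, F z ∂(sliceKernel ϱ hϱ (u * ϱ x)))
      (Set.Ioo (0 : ℝ) 1) := by
    have hm : StronglyMeasurable fun u : ℝ => ∫ z, F z ∂(sliceKernel ϱ hϱ (u * ϱ x)) :=
      hF.stronglyMeasurable.integral_kernel.comp_measurable (measurable_id.mul_const _)
    refine Measure.integrableOn_of_bounded (M := B) (by simp) hm.aestronglyMeasurable ?_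
    refine (ae_restrict_iff' measurableSet_Ioo).2 (Filter.Eventually.of_forall fun u hu => ?_)
    rw [hρ.integral_sliceKernel hp0 hϱ hform hF (mul_pos hu.1 (hpos x))
      ((mul_le_of_le_one_right hu.1.le (hle x)).trans_lt hu.2)]
    refine (norm_integral_le_of_norm_le_const (Filter.Eventually.of_forall fun z =>
      hB _)).trans ?_
    simp
  rw [integral_ussKernel hϱ hF hB (hpos x), integral_ussKernel hϱ hF hB (hpos y),
    ← integral_sub (hint x) (hint y), ← Real.norm_eq_abs]
  -- At a fixed relative level, compare the two slices through the same `z`: the gauge distances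
  -- differ by `ρ z` times the difference of the radii.
  have hpt : ∀ u ∈ Set.Ioo (0 : ℝ) 1,
      ‖(∫ z, F z ∂(sliceKernel ϱ hϱ (u * ϱ x))) - ∫ z, F z ∂(sliceKernel ϱ hϱ (u * ϱ y))‖ ≤
        u ^ (-1 / p) * (d / (d + 1) * L * |ρ (x - a) - ρ (y - a)|) := by
    intro u hu
    have hux (x) : 0 < u * ϱ x := mul_pos hu.1 (hpos x)
    have hux1 (x) : u * ϱ x < 1 := (mul_le_of_le_one_right hu.1.le (hle x)).trans_lt hu.2
    have hFi (R : ℝ) : Integrable (fun z => F (a + R • z)) (unitBallMeasure ρ) :=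
      Integrable.of_bound (hF.comp (by fun_prop)).aestronglyMeasurable B
        (Filter.Eventually.of_forall fun z => hB _)
    rw [hρ.integral_sliceKernel hp0 hϱ hform hF (hux x) (hux1 x),
      hρ.integral_sliceKernel hp0 hϱ hform hF (hux y) (hux1 y), ← integral_sub (hFi _) (hFi _)]
    have hrad := abs_sliceRadius_sub_le hp0 hu.1 hu.2.le (ρ (x - a)) (ρ (y - a))
    rw [← hform, ← hform] at hrad
    refine (norm_integral_le_of_norm_le
      (hρ.integrable_unitBallMeasure.const_mul
        (L * (u ^ (-1 / p) * |ρ (x - a) - ρ (y - a)|)))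
      (Filter.Eventually.of_forall fun z => ?_)).trans_eq ?_
    · refine (hL _ _).trans ?_
      rw [add_sub_cancel_left, add_sub_cancel_left,
        hρ.smul _ (sliceRadius_pos hp0 (hux x) (hux1 x)),
        hρ.smul _ (sliceRadius_pos hp0 (hux y) (hux1 y)), ← sub_mul, abs_mul,
        abs_of_nonneg (hρ.nonneg z), ← mul_assoc]
      exact mul_le_mul_of_nonneg_right (mul_le_mul_of_nonneg_left hrad hL0) (hρ.nonneg z)
    · rw [integral_const_mul, hρ.integral_unitBallMeasure]
      ring
  obtain ⟨hI, hIeq⟩ := integral_rpow_neg_inv hp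
  refine (norm_integral_le_of_norm_le (hI.mul_const _)
    ((ae_restrict_iff' measurableSet_Ioo).2 (Filter.Eventually.of_forall hpt))).trans_eq ?_
  rw [integral_mul_const, hIeq]
  ring

/-- The weight `ρ ^ 2` raises the exponent `-p / 2` by at most one, so the radial integral with `p -
2 > d` dominates. -/
theorem memLp_gauge (hρ : IsGauge ρ) (hp : d + 2 < p) (hϱ : Measurable ϱ)
    (hform : ∀ x, ϱ x = (1 + ρ (x - a) ^ 2) ^ (-p / 2)) :
    MemLp (fun x => ρ (x - a)) 2 (densityMeasure ϱ) := by
  have hma : Measurable fun x => ρ (x - a) := hρ.measurable.comp (measurable_id.sub_const a)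
  have hprob := hρ.isProbabilityMeasure_densityMeasure (by linarith) hϱ hform
  rw [memLp_two_iff_integrable_sq hma.aestronglyMeasurable]
  refine ⟨(hma.pow_const 2).aestronglyMeasurable, ?_⟩
  rw [hasFiniteIntegral_iff_ofReal (Filter.Eventually.of_forall fun x => sq_nonneg _),
    densityMeasure, lintegral_smul_measure, lintegral_withDensity_eq_lintegral_mul _
      hϱ.ennreal_ofReal (hma.pow_const 2).ennreal_ofReal, smul_eq_mul]
  refine ENNReal.mul_lt_top ?_ ?_
  · rw [ENNReal.inv_lt_top, pos_iff_ne_zero]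
    intro h0
    have h1 : densityMeasure ϱ Set.univ = 1 := measure_univ
    rw [densityMeasure, Measure.smul_apply, withDensity_apply _ .univ, Measure.restrict_univ, h0,
      smul_eq_mul, mul_zero] at h1
    exact zero_ne_one h1
  · refine lt_of_le_of_lt (lintegral_mono fun x => ?_)
      (hρ.lintegral_radial_ne_top a (p := p - 2) (by linarith)).lt_top
    rw [Pi.mul_apply, ← ENNReal.ofReal_mul (by rw [hform]; exact (radial_pos _ _).le)]
    refine ENNReal.ofReal_le_ofReal ?_
    have hpos : 0 < 1 + ρ (x - a) ^ 2 := by positivity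
    have h2 : -(p - 2) / 2 = -p / 2 + 1 := by ring
    rw [hform, h2, Real.rpow_add_one hpos.ne']
    exact mul_le_mul_of_nonneg_left (by linarith) (radial_pos _ _).le

/-- The classes of bounded functions that are `L`-Lipschitz with respect to the gauge distance. -/
def lipschitzClass (ρ : EuclideanSpace ℝ (Fin d) → ℝ) (a : EuclideanSpace ℝ (Fin d))
    (ν : Measure (EuclideanSpace ℝ (Fin d))) (L : ℝ) : Set (Lp ℝ 2 ν) :=
  {f | 0 ≤ L ∧ ∃ F : EuclideanSpace ℝ (Fin d) → ℝ, ∃ hF : MemLp F 2 ν, Measurable F ∧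
    (∃ B, ∀ x, |F x| ≤ B) ∧ (∀ x y, |F x - F y| ≤ L * |ρ (x - a) - ρ (y - a)|) ∧
    f = hF.toLp F}

/-- Centering does not affect the Lipschitz constant, and invariance gives mean zero, which is what
bounds the function by its Lipschitz constant. -/
theorem exists_lipschitz_of_mem_lipschitzClass (hρ : IsGauge ρ) (hp : d + 2 < p)
    (hϱ : Measurable ϱ) (hform : ∀ x, ϱ x = (1 + ρ (x - a) ^ 2) ^ (-p / 2))
    [IsMarkovKernel (ussKernel ϱ hϱ)] [IsProbabilityMeasure (densityMeasure ϱ)]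
    (hinv : (ussKernel ϱ hϱ).Invariant (densityMeasure ϱ)) {L : ℝ}
    {f : Lp ℝ 2 (densityMeasure ϱ)} (hf : f ∈ lipschitzClass ρ a (densityMeasure ϱ) L) :
    0 ≤ L ∧ ∃ F : EuclideanSpace ℝ (Fin d) → ℝ, ∃ hF : MemLp F 2 (densityMeasure ϱ),
      Measurable F ∧ (∃ B, ∀ x, |F x| ≤ B) ∧
      (∀ x y, |F x - F y| ≤ d / (d + 1) * (p / (p - 1)) * L * |ρ (x - a) - ρ (y - a)|) ∧
      ∫ x, F x ∂(densityMeasure ϱ) = 0 ∧ centeredOp hinv f = hF.toLp F := by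
  obtain ⟨hL0, F, hF, hFm, ⟨B, hB⟩, hL, rfl⟩ := hf
  refine ⟨hL0, fun x => (∫ y, F y ∂(ussKernel ϱ hϱ x)) - ∫ y, F y ∂(densityMeasure ϱ),
    memLp_centered hinv hF, ?_, ⟨B + B, fun x => ?_⟩, fun x y => ?_, ?_, centeredOp_toLp hinv hF⟩
  · exact (hFm.stronglyMeasurable.integral_kernel.measurable).sub_const _
  · have hb (μ : Measure (EuclideanSpace ℝ (Fin d))) [IsProbabilityMeasure μ] :
        |∫ y, F y ∂μ| ≤ B := by
      have := norm_integral_le_of_norm_le_const (μ := μ) (f := F) (C := B)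
        (Filter.Eventually.of_forall hB)
      simpa using this
    exact (abs_sub _ _).trans (add_le_add (hb _) (hb _))
  · rw [sub_sub_sub_cancel_right]
    have h0 : (0 : ℝ) ≤ d := Nat.cast_nonneg d
    exact hρ.abs_integral_ussKernel_sub_le (by linarith) hϱ hform hFm hB hL hL0 x y
  · have hFi := hF.integrable one_le_two
    rw [integral_sub ((memLp_integral_kernel hinv hF).integrable one_le_two)
      (integrable_const _), integral_kernel_integral hinv hFi]
    simp

theorem contraction_nonneg (d : ℕ) {p : ℝ} (hp : d + 2 < p) :
    (0 : ℝ) ≤ d / (d + 1) * (p / (p - 1)) := by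
  have h0 : (0 : ℝ) ≤ d := Nat.cast_nonneg d
  have : 0 < p - 1 := by linarith
  have : 0 < p := by linarith
  positivity

/-- With mean zero, `F x` is the average of `F x - F y` over `y`. The bound does not involve the
supremum of `F`. -/
theorem abs_le_of_integral_eq_zero {ν : Measure (EuclideanSpace ℝ (Fin d))}
    [IsProbabilityMeasure ν] (hρ : IsGauge ρ) (hρν : Integrable (fun x => ρ (x - a)) ν)
    {F : EuclideanSpace ℝ (Fin d) → ℝ} (hF : Integrable F ν) (h0 : ∫ x, F x ∂ν = 0) {L : ℝ}
    (hL0 : 0 ≤ L) (hL : ∀ x y, |F x - F y| ≤ L * |ρ (x - a) - ρ (y - a)|)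
    (x : EuclideanSpace ℝ (Fin d)) :
    |F x| ≤ L * (ρ (x - a) + ∫ y, ρ (y - a) ∂ν) := by
  have h1 : F x = ∫ y, (F x - F y) ∂ν := by
    rw [integral_sub (integrable_const _) hF, h0]
    simp
  rw [h1, ← Real.norm_eq_abs]
  refine (norm_integral_le_of_norm_le
    (((integrable_const (ρ (x - a))).add hρν).const_mul L)
    (Filter.Eventually.of_forall fun y => ?_)).trans_eq ?_
  · refine (hL x y).trans (mul_le_mul_of_nonneg_left ?_ hL0)
    refine (abs_sub _ _).trans_eq ?_
    rw [abs_of_nonneg (hρ.nonneg _), abs_of_nonneg (hρ.nonneg _)]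
    rfl
  · rw [integral_const_mul]
    simp only [Pi.add_apply]
    rw [integral_add (integrable_const _) hρν]
    simp

theorem norm_centeredOp_le_of_mem_lipschitzClass (hρ : IsGauge ρ) (hp : d + 2 < p)
    (hϱ : Measurable ϱ) (hform : ∀ x, ϱ x = (1 + ρ (x - a) ^ 2) ^ (-p / 2))
    [IsMarkovKernel (ussKernel ϱ hϱ)] [IsProbabilityMeasure (densityMeasure ϱ)]
    (hinv : (ussKernel ϱ hϱ).Invariant (densityMeasure ϱ)) :
    ∃ C : ℝ, ∀ L, ∀ f ∈ lipschitzClass ρ a (densityMeasure ϱ) L,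
      ‖centeredOp hinv f‖ ≤ C * L := by
  have hρL := hρ.memLp_gauge hp hϱ hform
  have hW := hρL.add (memLp_const (∫ y, ρ (y - a) ∂(densityMeasure ϱ)))
  refine ⟨d / (d + 1) * (p / (p - 1)) * ‖hW.toLp _‖, fun L f hf => ?_⟩
  obtain ⟨hL0, F, hF, -, -, hL, hF0, hfF⟩ :=
    hρ.exists_lipschitz_of_mem_lipschitzClass hp hϱ hform hinv hf
  have hβL := mul_nonneg (contraction_nonneg d hp) hL0
  have hle := Lp.norm_le_mul_norm_of_ae_le_mul (f := hF.toLp F) (g := hW.toLp _)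
    (c := d / (d + 1) * (p / (p - 1)) * L) <| by
      filter_upwards [hF.coeFn_toLp, hW.coeFn_toLp] with x hx hx'
      rw [hx, hx', Real.norm_eq_abs, Real.norm_eq_abs]
      refine (hρ.abs_le_of_integral_eq_zero (hρL.integrable one_le_two)
        (hF.integrable one_le_two) hF0 hβL hL x).trans ?_
      exact mul_le_mul_of_nonneg_left (le_abs_self _) hβL
  rw [hfF]
  exact hle.trans_eq (by ring)

/-- Under the law of `ρ (x - a)` on the line, smooth compactly supported functions are dense in
`L₂`; they are bounded and Lipschitz, and composing with the gauge preserves the `L₂` distance. -/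
theorem toLp_mem_closure_lipschitzClass {ν : Measure (EuclideanSpace ℝ (Fin d))}
    [IsProbabilityMeasure ν] (hρ : IsGauge ρ) {k : ℝ → ℝ} (hk : Measurable k)
    (hkρ : MemLp (fun x => k (ρ (x - a))) 2 ν) :
    hkρ.toLp _ ∈ closure (⋃ L, lipschitzClass ρ a ν L) := by
  have hma : Measurable fun x => ρ (x - a) := hρ.measurable.comp (measurable_id.sub_const a)
  have : IsProbabilityMeasure (ν.map fun x => ρ (x - a)) :=
    Measure.isProbabilityMeasure_map hma.aemeasurable
  have hkm : MemLp k 2 (ν.map fun x => ρ (x - a)) :=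
    (memLp_map_measure_iff hk.aestronglyMeasurable hma.aemeasurable).2 hkρ
  refine Metric.mem_closure_iff.2 fun ε hε => ?_
  obtain ⟨g, hgs, hgd, hgε⟩ := hkm.exist_eLpNorm_sub_le ENNReal.ofNat_ne_top one_le_two
    (half_pos hε)
  obtain ⟨B, hB⟩ := hgs.exists_bound_of_continuous hgd.continuous
  have hgm : Measurable fun x => g (ρ (x - a)) := hgd.continuous.measurable.comp hma
  have hgρ : MemLp (fun x => g (ρ (x - a))) 2 ν :=
    MemLp.of_bound hgm.aestronglyMeasurable B (Filter.Eventually.of_forall fun x => hB _)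
  obtain ⟨K, hK⟩ := (hgd.lipschitzWith_of_hasCompactSupport hgs (by simp) :
    ∃ K, LipschitzWith K g)
  refine ⟨hgρ.toLp _, Set.mem_iUnion.2 ⟨K, K.2, _, hgρ, hgm, ⟨B, fun x => hB _⟩,
    fun x y => ?_, rfl⟩, ?_⟩
  · simpa [Real.dist_eq] using hK.dist_le_mul (ρ (x - a)) (ρ (y - a))
  · rw [dist_eq_norm, ← MemLp.toLp_sub, Lp.norm_toLp]
    refine lt_of_le_of_lt (ENNReal.toReal_le_of_le_ofReal (half_pos hε).le ?_) (half_lt_self hε)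
    rwa [eLpNorm_map_measure (hkm.1.sub hgd.continuous.aestronglyMeasurable)
      hma.aemeasurable] at hgε

theorem centeredOp_mem_closure_lipschitzClass (hρ : IsGauge ρ)
    (hϱ : Measurable ϱ) (hform : ∀ x, ϱ x = (1 + ρ (x - a) ^ 2) ^ (-p / 2))
    [IsMarkovKernel (ussKernel ϱ hϱ)] [IsProbabilityMeasure (densityMeasure ϱ)]
    (hinv : (ussKernel ϱ hϱ).Invariant (densityMeasure ϱ)) (h : Lp ℝ 2 (densityMeasure ϱ)) :
    centeredOp hinv h ∈ closure (⋃ L, lipschitzClass ρ a (densityMeasure ϱ) L) := by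
  have hm : Measurable fun s : ℝ =>
      (∫ y, h y ∂((sliceKernel ϱ hϱ ∘ₖ uniformIooKernel) ((1 + s ^ 2) ^ (-p / 2)))) -
        ∫ y, h y ∂(densityMeasure ϱ) :=
    ((Lp.stronglyMeasurable h).integral_kernel.measurable.comp
      (((measurable_id.pow_const 2).const_add 1).pow_const _)).sub_const _
  have heq : (fun x => (∫ y, h y ∂(ussKernel ϱ hϱ x)) - ∫ y, h y ∂(densityMeasure ϱ)) =
      fun x => (fun s : ℝ =>
      (∫ y, h y ∂((sliceKernel ϱ hϱ ∘ₖ uniformIooKernel) ((1 + s ^ 2) ^ (-p / 2)))) -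
        ∫ y, h y ∂(densityMeasure ϱ)) (ρ (x - a)) := by
    funext x
    simp only [ussKernel_apply_eq hϱ, hform x]
  have hL := memLp_centered hinv (Lp.memLp h)
  rw [heq] at hL
  have := hρ.toLp_mem_closure_lipschitzClass hm hL
  rw [centeredOp_apply]
  convert this using 1
  exact MemLp.toLp_congr _ _ (Filter.EventuallyEq.of_eq heq)

theorem uss_spectralGap (hρ : IsGauge ρ) (hd : 1 ≤ d) (hp : d + 2 < p)
    (hϱ : Measurable ϱ) (hform : ∀ x, ϱ x = (1 + ρ (x - a) ^ 2) ^ (-p / 2)) :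
    IsProbabilityMeasure (densityMeasure ϱ) ∧ IsMarkovKernel (ussKernel ϱ hϱ) ∧
      (ussKernel ϱ hϱ).Invariant (densityMeasure ϱ) ∧
      ((1 - d * p / ((d + 1) * (p - 1)) : ℝ) : EReal) ≤
        spectralGap (ussKernel ϱ hϱ) (densityMeasure ϱ) := by
  have h0 : (1 : ℝ) ≤ d := by exact_mod_cast hd
  have hprob := hρ.isProbabilityMeasure_densityMeasure (by linarith) hϱ hform
  have hmark := hρ.isMarkovKernel_uss (by linarith) hϱ hform
  have hrev := isReversible_ussKernel hϱ fun x => by rw [hform]; exact radial_pos _ _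
  refine ⟨hprob, hmark, hrev.invariant, ?_⟩
  -- The rate must be strictly positive, as the Hilbert space argument divides by it; hence `d ≥ 1`.
  have hβ : (0 : ℝ) < d / (d + 1) * (p / (p - 1)) := by
    have : 0 < p - 1 := by linarith
    have : 0 < p := by linarith
    positivity
  obtain ⟨C, hC⟩ := hρ.norm_centeredOp_le_of_mem_lipschitzClass hp hϱ hform hrev.invariant
  rw [← div_mul_div_comm]
  refine le_spectralGap_of_opNormSub_le hβ.le (opNormSub_le hrev.invariant hβ.le ?_)
  refine norm_apply_le_of_range_subset_closure (inner_centeredOp hrev) hβ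
    (lipschitzClass ρ a (densityMeasure ϱ)) (fun L f hf => ?_) hC
    (hρ.centeredOp_mem_closure_lipschitzClass hϱ hform hrev.invariant)
  obtain ⟨hL0, F, hF, hFm, hB, hL, -, hfF⟩ :=
    hρ.exists_lipschitz_of_mem_lipschitzClass hp hϱ hform hrev.invariant hf
  exact ⟨mul_nonneg hβ.le hL0, F, hF, hFm, hB, hL, hfF⟩

end IsGauge

end SliceSampling

/-! ### The two families of densities as radial functions of a gauge. -/

namespace SliceSampling

variable {d : ℕ}

theorem sliceRadius_radial {p s : ℝ} (hp : 0 < p) (hs : 0 ≤ s) :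
    sliceRadius p ((1 + s ^ 2) ^ (-p / 2)) = s := by
  have := sliceRadius_mul_radial hp one_pos s
  simpa [Real.sqrt_sq hs] using this

theorem exists_eq_smul_sphere (hd : 1 ≤ d) (x : EuclideanSpace ℝ (Fin d)) :
    ∃ r : ℝ, 0 ≤ r ∧ ∃ θ : Metric.sphere (0 : EuclideanSpace ℝ (Fin d)) 1,
      x = r • (θ : EuclideanSpace ℝ (Fin d)) := by
  have : Nonempty (Fin d) := ⟨⟨0, hd⟩⟩
  rcases eq_or_ne x 0 with rfl | hx
  · obtain ⟨θ, hθ⟩ := NormedSpace.sphere_nonempty (x := (0 : EuclideanSpace ℝ (Fin d))).2 zero_le_one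
    exact ⟨0, le_rfl, ⟨θ, hθ⟩, by simp⟩
  · refine ⟨‖x‖, norm_nonneg x, ⟨‖x‖⁻¹ • x, ?_⟩, ?_⟩
    · simp [norm_smul, hx]
    · simp [smul_smul, hx]

/-- Inverting the profile recovers the gauge from the density, so it is measurable because `ϱ` is.
On the ray through `θ` it equals `√(χ θ / m) * r`, which gives homogeneity. On its unit ball `ϱ ≥ 2
^ (-p / 2)`, so Markov's inequality bounds the volume. -/
theorem isGauge_of_sphere (hd : 1 ≤ d) {m p : ℝ} (hm : 0 < m) (hp : 0 < p)
    {χ : Metric.sphere (0 : EuclideanSpace ℝ (Fin d)) 1 → ℝ} (hχ : ∀ θ, 0 < χ θ)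
    {ϱ : EuclideanSpace ℝ (Fin d) → ℝ} (hϱ : Measurable ϱ)
    (hform : ∀ (r : ℝ) (θ : Metric.sphere (0 : EuclideanSpace ℝ (Fin d)) 1), 0 ≤ r →
      ϱ (r • (θ : EuclideanSpace ℝ (Fin d))) = (1 + 1 / m * χ θ * r ^ 2) ^ (-p / 2))
    [hprob : IsProbabilityMeasure (densityMeasure ϱ)] :
    (∀ x, ϱ x = (1 + sliceRadius p (ϱ (x - 0)) ^ 2) ^ (-p / 2)) ∧
      IsGauge fun x => sliceRadius p (ϱ x) := by
  have hrad (r : ℝ) (θ : Metric.sphere (0 : EuclideanSpace ℝ (Fin d)) 1) (hr : 0 ≤ r) :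
      ϱ (r • (θ : EuclideanSpace ℝ (Fin d))) = (1 + (√(1 / m * χ θ) * r) ^ 2) ^ (-p / 2) := by
    have := hχ θ
    rw [hform r θ hr, mul_pow, Real.sq_sqrt (by positivity)]
  have hR (r : ℝ) (θ : Metric.sphere (0 : EuclideanSpace ℝ (Fin d)) 1) (hr : 0 ≤ r) :
      sliceRadius p (ϱ (r • (θ : EuclideanSpace ℝ (Fin d)))) = √(1 / m * χ θ) * r := by
    rw [hrad r θ hr, sliceRadius_radial hp (by positivity)]
  have hform' (x) : ϱ x = (1 + sliceRadius p (ϱ x) ^ 2) ^ (-p / 2) := by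
    obtain ⟨r, hr, θ, rfl⟩ := exists_eq_smul_sphere hd x
    rw [hR r θ hr, hrad r θ hr]
  refine ⟨by simpa using hform', ?_, fun x => Real.sqrt_nonneg _, fun c hc x => ?_, ?_⟩
  · exact ((hϱ.pow_const _).sub_const _).sqrt
  · obtain ⟨r, hr, θ, rfl⟩ := exists_eq_smul_sphere hd x
    rw [smul_smul, hR _ θ (by positivity), hR r θ hr]
    ring
  -- With infinite mass the normalizing factor is `∞⁻¹ = 0`, and `densityMeasure ϱ` would vanish.
  · have hfin : ∫⁻ x, ENNReal.ofReal (ϱ x) ≠ ∞ := by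
      intro h
      have h1 := hprob.measure_univ
      simp [densityMeasure, h] at h1
    have hc : 0 < (2 : ℝ) ^ (-p / 2) := by positivity
    refine ne_top_of_le_ne_top ?_ (measure_mono
      (t := {x | ENNReal.ofReal (2 ^ (-p / 2)) ≤ ENNReal.ofReal (ϱ x)}) fun x hx => ?_)
    · refine ne_top_of_le_ne_top ?_ (meas_ge_le_lintegral_div hϱ.ennreal_ofReal.aemeasurable
        (by simpa using hc) ENNReal.ofReal_ne_top)
      exact ENNReal.div_ne_top hfin (by simpa using hc)
    · refine ENNReal.ofReal_le_ofReal ?_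
      rw [hform' x]
      have h0 : 0 ≤ sliceRadius p (ϱ x) := Real.sqrt_nonneg _
      have h1 : sliceRadius p (ϱ x) < 1 := hx
      exact Real.rpow_le_rpow_of_nonpos (by positivity) (by nlinarith) (by linarith)

theorem dotProduct_inv_mulVec_pos {S : Matrix (Fin d) (Fin d) ℝ} (hS : S.PosDef)
    {v : Fin d → ℝ} (hv : v ≠ 0) : 0 < v ⬝ᵥ (S⁻¹ *ᵥ v) := by
  simpa using hS.inv.dotProduct_mulVec_pos hv

theorem dotProduct_inv_mulVec_nonneg {S : Matrix (Fin d) (Fin d) ℝ} (hS : S.PosDef)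
    (v : Fin d → ℝ) : 0 ≤ v ⬝ᵥ (S⁻¹ *ᵥ v) := by
  rcases eq_or_ne v 0 with rfl | hv
  · simp
  · exact (dotProduct_inv_mulVec_pos hS hv).le

theorem tDensity_eq_radial {m : ℝ} (hm : 0 < m) (a : EuclideanSpace ℝ (Fin d))
    {S : Matrix (Fin d) (Fin d) ℝ} (hS : S.PosDef) (x : EuclideanSpace ℝ (Fin d)) :
    tDensity m a S x =
      (1 + √(1 / m * ((x - a).ofLp ⬝ᵥ (S⁻¹ *ᵥ (x - a).ofLp))) ^ 2) ^ (-((d : ℝ) + m) / 2) := by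
  rw [tDensity, Real.sq_sqrt (mul_nonneg (by positivity) (dotProduct_inv_mulVec_nonneg hS _))]

theorem isGauge_of_posDef (hd : 1 ≤ d) {m : ℝ} (hm : 0 < m) {S : Matrix (Fin d) (Fin d) ℝ}
    (hS : S.PosDef) :
    IsGauge fun x : EuclideanSpace ℝ (Fin d) => √(1 / m * (x.ofLp ⬝ᵥ (S⁻¹ *ᵥ x.ofLp))) := by
  have hcont : Continuous fun x : EuclideanSpace ℝ (Fin d) =>
      √(1 / m * (x.ofLp ⬝ᵥ (S⁻¹ *ᵥ x.ofLp))) := by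
    unfold dotProduct Matrix.mulVec dotProduct
    fun_prop
  have hsmul (c : ℝ) (hc : 0 ≤ c) (x : EuclideanSpace ℝ (Fin d)) :
      √(1 / m * ((c • x).ofLp ⬝ᵥ (S⁻¹ *ᵥ (c • x).ofLp))) =
        c * √(1 / m * (x.ofLp ⬝ᵥ (S⁻¹ *ᵥ x.ofLp))) := by
    rw [WithLp.ofLp_smul, Matrix.mulVec_smul, smul_dotProduct, dotProduct_smul, smul_eq_mul,
      smul_eq_mul, ← Real.sqrt_sq hc, ← Real.sqrt_mul (sq_nonneg c), Real.sqrt_sq hc]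
    congr 1
    ring
  refine ⟨hcont.measurable, fun x => Real.sqrt_nonneg _, fun c hc x => hsmul c hc.le x, ?_⟩
  have : Nonempty (Fin d) := ⟨⟨0, hd⟩⟩
  -- The minimum of the gauge over the compact Euclidean sphere is positive, and its inverse is the
  -- radius of a Euclidean ball containing the unit ball of the gauge.
  obtain ⟨θ, hθ, hmin⟩ := (isCompact_sphere (0 : EuclideanSpace ℝ (Fin d)) 1).exists_isMinOn
    (NormedSpace.sphere_nonempty.2 zero_le_one) hcont.continuousOn
  have hθ0 : θ.ofLp ≠ 0 := by
    intro h
    have h0 : θ = 0 := by ext i; simp [h]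
    simp [h0] at hθ
  have hc : 0 < √(1 / m * (θ.ofLp ⬝ᵥ (S⁻¹ *ᵥ θ.ofLp))) :=
    Real.sqrt_pos.2 (mul_pos (by positivity) (dotProduct_inv_mulVec_pos hS hθ0))
  refine ne_top_of_le_ne_top (measure_ball_lt_top (μ := volume)
    (x := (0 : EuclideanSpace ℝ (Fin d)))
    (r := (√(1 / m * (θ.ofLp ⬝ᵥ (S⁻¹ *ᵥ θ.ofLp))))⁻¹)).ne (measure_mono fun x hx => ?_)
  obtain ⟨r, hr, η, rfl⟩ := exists_eq_smul_sphere hd x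
  have h1 : r * √(1 / m * (η.1.ofLp ⬝ᵥ (S⁻¹ *ᵥ η.1.ofLp))) < 1 := by
    rw [← hsmul r hr]
    exact hx
  have h2 := hmin η.2
  have h3 : ‖(η : EuclideanSpace ℝ (Fin d))‖ = 1 := by simp
  rw [mem_ball_zero_iff, norm_smul, h3, mul_one, Real.norm_of_nonneg hr, ← one_div,
    lt_div_iff₀ hc]
  exact (mul_le_mul_of_nonneg_left h2 hr).trans_lt h1

end SliceSampling

theorem theorem3p7 (d : ℕ) (hd : 1 ≤ d) (m : ℝ) (hm : 2 < m) :
    (∀ (χ : Metric.sphere (0 : EuclideanSpace ℝ (Fin d)) 1 → ℝ)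
        (_ : Measurable χ) (_ : ∀ θ, 0 < χ θ)
        (ϱ : EuclideanSpace ℝ (Fin d) → ℝ) (hϱ : Measurable ϱ)
        (_ : ∀ (r : ℝ) (θ : Metric.sphere (0 : EuclideanSpace ℝ (Fin d)) 1), 0 ≤ r →
          ϱ (r • (θ : EuclideanSpace ℝ (Fin d))) =
            (1 + 1 / m * χ θ * r ^ 2) ^ (-((d : ℝ) + m) / 2))
        (π : Measure (EuclideanSpace ℝ (Fin d))) (_ : IsProbabilityMeasure π)
        (_ : π = SliceSampling.densityMeasure ϱ),
      IsMarkovKernel (SliceSampling.ussKernel ϱ hϱ) ∧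
      Kernel.Invariant (SliceSampling.ussKernel ϱ hϱ) π ∧
      ((1 - (d : ℝ) * (d + m) / (((d : ℝ) + 1) * (d + m - 1)) : ℝ) : EReal) ≤
        SliceSampling.spectralGap (SliceSampling.ussKernel ϱ hϱ) π) ∧
    (∀ (a : EuclideanSpace ℝ (Fin d)) (S : Matrix (Fin d) (Fin d) ℝ) (_ : S.PosDef),
      IsProbabilityMeasure (SliceSampling.densityMeasure (SliceSampling.tDensity m a S)) ∧
      IsMarkovKernel (SliceSampling.ussKernel (SliceSampling.tDensity m a S)
        (SliceSampling.measurable_tDensity m a S)) ∧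
      Kernel.Invariant (SliceSampling.ussKernel (SliceSampling.tDensity m a S)
        (SliceSampling.measurable_tDensity m a S))
        (SliceSampling.densityMeasure (SliceSampling.tDensity m a S)) ∧
      ((1 - (d : ℝ) * (d + m) / (((d : ℝ) + 1) * (d + m - 1)) : ℝ) : EReal) ≤
        SliceSampling.spectralGap (SliceSampling.ussKernel (SliceSampling.tDensity m a S)
          (SliceSampling.measurable_tDensity m a S))
          (SliceSampling.densityMeasure (SliceSampling.tDensity m a S))) := by
  have hd0 : (1 : ℝ) ≤ d := by exact_mod_cast hd
  have hp : (d : ℝ) + 2 < d + m := by linarith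
  constructor
  · intro χ _ hχ ϱ hϱ hform π hπ hπϱ
    subst hπϱ
    have hg := SliceSampling.isGauge_of_sphere hd (by linarith) (by linarith) hχ hϱ hform
    exact (hg.2.uss_spectralGap hd hp hϱ hg.1).2
  · intro a S hS
    exact (SliceSampling.isGauge_of_posDef hd (by linarith : (0 : ℝ) < m) hS).uss_spectralGap hd hp
      (SliceSampling.measurable_tDensity m a S)
      (SliceSampling.tDensity_eq_radial (by linarith) a hS)
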